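/- Let $0<\alpha\le 2$ and let $S_\alpha$ be a symmetric stable random variable with characteristic function $\mathbb{E}\,e^{\mathrm{i}tS_\alpha}=e^{-|t|^\alpha}$ for all $t\in\mathbb{R}$. Then $S_\alpha\neq 0$ almost surely, and for every complex $s$ with $-1<\operatorname{Re}s<\alpha$ the random variable $|S_\alpha|^s$ is integrable and $$\mathbb{E}|S_\alpha|^s=2^s\,\frac{\Gamma\bigl(\frac{1+s}{2}\bigr)\,\Gamma\bigl(1-\frac{s}{\alpha}\bigr)}{\sqrt{\pi}\,\Gamma\bigl(1-\frac{s}{2}\bigr)}.$$ If $\alpha=1$, then $S_1$ has the Cauchy distribution with density $\frac{1}{\pi(1+x^2)}$, $x\in\mathbb{R}$, and for every complex $s$ with $-1<\operatorname{Re}s<1$ $$\mathbb{E}|S_1|^s=\frac{\Gamma\bigl(\frac{1+s}{2}\bigr)\,\Gamma\bigl(\frac{1-s}{2}\bigr)}{\pi}=\frac{1}{\cos\frac{\pi s}{2}}.$$ -/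

import Mathlib

open MeasureTheory ProbabilityTheory

/-- `S` is a symmetric stable random variable of index `α`: its characteristic function
`t ↦ E e^{itS}` is `e^{-|t|^α}`. -/
def IsSymmetricStable {Ω : Type*} [MeasurableSpace Ω] (S : Ω → ℝ) (α : ℝ) (μ : Measure Ω) :
    Prop :=
  AEMeasurable S μ ∧ ∀ t : ℝ, charFun (μ.map S) t = (Real.exp (-(|t| ^ α)) : ℂ)

/-! Let `G` be centred Gaussian of variance 2, so that `E e^{iyG} = e^{-y²}`. Averaging `e^{i√u xg}`
over the laws of `S` and `G` in either order (Fubini) gives `E e^{-u S²} = E e^{-u^{α/2}|G|^α}` for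
all `u > 0` (`integral_exp_neg_sq_of_charFun`). Everything about the moments of `S` is read off from
this identity. Letting `u → ∞` shows that `S` has no atom at 0. Differentiating in `u` and taking a
Mellin transform gives `Γ(1 - s/2) E|S|^s = Γ(1 - s/α) E|G|^s` (`integral_cpow_of_laplace_eq`), and
the Gaussian moment is an explicit Gamma integral. Differentiating first matters: the Mellin
integral of the derivative converges for both signs of `Re s`, that of the Laplace transform itself
only for `Re s < 0`. For `α = 1`, Fourier inversion identifies the law as Cauchy, and the
duplication and reflection formulas simplify the moment. -/

/-! ### Differentiating Laplace transforms -/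

/-- The kernel `a β u^(β-1) e^{-a u^β}`, which is minus the derivative of `u ↦ e^{-a u^β}`. -/
noncomputable def laplaceKernel (β a u : ℝ) : ℝ :=
  a * β * u ^ (β - 1) * Real.exp (-(a * u ^ β))

theorem laplaceKernel_nonneg {β a u : ℝ} (hβ : 0 < β) (ha : 0 ≤ a) (hu : 0 < u) :
    0 ≤ laplaceKernel β a u := by
  unfold laplaceKernel; positivity

/-- This is `y e^{-y} ≤ 1` with `y = a u^β`. The bound is free of `a`, so it dominates the
derivative under the expectation without any moment of `A`. -/
theorem laplaceKernel_le {β a u : ℝ} (hβ : 0 < β) (hu : 0 < u) :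
    laplaceKernel β a u ≤ β / u := by
  have h : a * u ^ β * Real.exp (-(a * u ^ β)) ≤ 1 := by
    have := Real.add_one_le_exp (a * u ^ β)
    rw [Real.exp_neg, ← div_eq_mul_inv, div_le_one (Real.exp_pos _)]
    linarith
  calc laplaceKernel β a u
      = β / u * (a * u ^ β * Real.exp (-(a * u ^ β))) := by
        rw [laplaceKernel, Real.rpow_sub_one hu.ne']; ring
    _ ≤ β / u * 1 := by gcongr
    _ = β / u := mul_one _

theorem hasDerivAt_exp_neg_mul_rpow {β a u : ℝ} (hu : 0 < u) :
    HasDerivAt (fun u : ℝ => Real.exp (-(a * u ^ β))) (-laplaceKernel β a u) u := by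
  have h := ((Real.hasDerivAt_rpow_const (p := β) (Or.inl hu.ne')).const_mul a).neg.exp
  exact h.congr_deriv (by unfold laplaceKernel; simp only [Pi.neg_apply]; ring)

theorem measurable_laplaceKernel (β : ℝ) : Measurable (Function.uncurry (laplaceKernel β)) := by
  unfold laplaceKernel Function.uncurry; fun_prop

/-- Differentiation of `u ↦ E e^{-A u^β}` under the expectation. -/
theorem hasDerivAt_integral_exp_neg_mul_rpow {Ω : Type*} [MeasurableSpace Ω] {P : Measure Ω}
    [IsProbabilityMeasure P] {A : Ω → ℝ} (hA : Measurable A) (hA0 : ∀ ω, 0 ≤ A ω) {β u : ℝ}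
    (hβ : 0 < β) (hu : 0 < u) :
    Integrable (fun ω => laplaceKernel β (A ω) u) P ∧
      HasDerivAt (fun u : ℝ => ∫ ω, Real.exp (-(A ω * u ^ β)) ∂P)
        (-∫ ω, laplaceKernel β (A ω) u ∂P) u := by
  have hK : Measurable (fun ω => laplaceKernel β (A ω) u) :=
    (measurable_laplaceKernel β).comp (hA.prodMk measurable_const)
  have h := hasDerivAt_integral_of_dominated_loc_of_deriv_le (μ := P) (𝕜 := ℝ)
    (F := fun u ω => Real.exp (-(A ω * u ^ β))) (F' := fun u ω => -laplaceKernel β (A ω) u)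
    -- Staying above `u / 2` makes the bound `β / v` uniform in `v`.
    (x₀ := u) (s := Set.Ioi (u / 2)) (bound := fun _ => β / (u / 2))
    (Ioi_mem_nhds (by linarith))
    (Filter.Eventually.of_forall fun v => by
      have : Measurable fun ω => Real.exp (-(A ω * v ^ β)) := by fun_prop
      exact this.aestronglyMeasurable)
    (by
      refine Integrable.of_bound (C := 1) (by
        have : Measurable fun ω => Real.exp (-(A ω * u ^ β)) := by fun_prop
        exact this.aestronglyMeasurable) (Filter.Eventually.of_forall fun ω => ?_)
      rw [Real.norm_eq_abs, Real.abs_exp, Real.exp_le_one_iff, neg_nonpos]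
      exact mul_nonneg (hA0 ω) (Real.rpow_nonneg hu.le _))
    hK.neg.aestronglyMeasurable
    (Filter.Eventually.of_forall fun ω v hv => by
      have hv0 : 0 < v := (half_pos hu).trans hv
      rw [norm_neg, Real.norm_eq_abs, abs_of_nonneg (laplaceKernel_nonneg hβ (hA0 ω) hv0)]
      exact (laplaceKernel_le hβ hv0).trans
        (div_le_div_of_nonneg_left hβ.le (half_pos hu) (le_of_lt hv)))
    (integrable_const _)
    (Filter.Eventually.of_forall fun ω v hv =>
      hasDerivAt_exp_neg_mul_rpow ((half_pos hu).trans hv))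
  rw [integral_neg] at h
  exact ⟨by simpa using h.1.neg, h.2⟩

/-! ### Mellin transforms and transfer of moments -/

theorem mellin_exp_neg {z : ℂ} (hz : 0 < z.re) :
    MellinConvergent (fun t : ℝ => (Real.exp (-t) : ℂ)) z ∧
      mellin (fun t : ℝ => (Real.exp (-t) : ℂ)) z = Complex.Gamma z := by
  constructor
  · refine (Complex.GammaIntegral_convergent hz).congr_fun (fun t _ => ?_) measurableSet_Ioi
    simp [mul_comm]
  · rw [Complex.Gamma_eq_integral hz, Complex.GammaIntegral, mellin]
    refine setIntegral_congr_fun measurableSet_Ioi fun t _ => ?_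
    simp [mul_comm]

theorem mellin_exp_neg_mul_rpow {a β : ℝ} (ha : 0 < a) (hβ : 0 < β) {z : ℂ} (hz : 0 < z.re) :
    MellinConvergent (fun t : ℝ => (Real.exp (-(a * t ^ β)) : ℂ)) z ∧
      mellin (fun t : ℝ => (Real.exp (-(a * t ^ β)) : ℂ)) z =
        (β : ℂ)⁻¹ * (a : ℂ) ^ (-(z / β)) * Complex.Gamma (z / β) := by
  have hz' : 0 < (z / β).re := by rw [Complex.div_ofReal_re]; positivity
  obtain ⟨h1, h2⟩ := mellin_exp_neg hz'
  constructor
  · exact (MellinConvergent.comp_rpow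
      (f := fun t : ℝ => (Real.exp (-(a * t)) : ℂ)) hβ.ne').2
      ((MellinConvergent.comp_mul_left (f := fun t : ℝ => (Real.exp (-t) : ℂ)) ha).2 h1)
  · rw [mellin_comp_rpow (fun t : ℝ => (Real.exp (-(a * t)) : ℂ)),
      mellin_comp_mul_left (fun t : ℝ => (Real.exp (-t) : ℂ)) _ ha, h2, abs_of_pos hβ]
    simp [mul_assoc]

/-- The Mellin transform of the kernel. -/
theorem integral_cpow_mul_laplaceKernel {a β : ℝ} (ha : 0 < a) (hβ : 0 < β) {z : ℂ}
    (hz : z.re < 1) :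
    IntegrableOn (fun u : ℝ => (u : ℂ) ^ (-(β * z)) * (laplaceKernel β a u : ℂ)) (Set.Ioi 0) ∧
      ∫ u in Set.Ioi (0 : ℝ), (u : ℂ) ^ (-(β * z)) * (laplaceKernel β a u : ℂ) =
        Complex.Gamma (1 - z) * (a : ℂ) ^ z := by
  have hβ' : (β : ℂ) ≠ 0 := by exact_mod_cast hβ.ne'
  have hw : 0 < ((β : ℂ) * (1 - z)).re := by
    rw [Complex.re_ofReal_mul, Complex.sub_re, Complex.one_re]
    exact mul_pos hβ (by linarith)
  obtain ⟨h1, h2⟩ := mellin_exp_neg_mul_rpow ha hβ hw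
  have hE : Set.EqOn (fun u : ℝ => (a * β : ℂ) * ((u : ℂ) ^ ((β : ℂ) * (1 - z) - 1) •
      (Real.exp (-(a * u ^ β)) : ℂ)))
      (fun u : ℝ => (u : ℂ) ^ (-(β * z)) * (laplaceKernel β a u : ℂ)) (Set.Ioi 0) := by
    intro u hu
    have hu' : (u : ℂ) ≠ 0 := by exact_mod_cast (ne_of_gt hu)
    have : (β : ℂ) * (1 - z) - 1 = -(β * z) + ((β - 1 : ℝ) : ℂ) := by push_cast; ring
    simp only [laplaceKernel, smul_eq_mul]
    rw [this, Complex.cpow_add _ _ hu', ← Complex.ofReal_cpow (le_of_lt hu)]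
    push_cast; ring
  refine ⟨IntegrableOn.congr_fun (h1.const_mul _) hE measurableSet_Ioi, ?_⟩
  rw [← setIntegral_congr_fun measurableSet_Ioi hE, integral_const_mul]
  change _ * mellin _ _ = _
  have ha' : (a : ℂ) ≠ 0 := by exact_mod_cast ha.ne'
  rw [h2, mul_div_cancel_left₀ _ hβ', neg_sub, Complex.cpow_sub _ _ ha', Complex.cpow_one]
  field_simp

/-- Since the kernel is nonnegative, taking norms only replaces `z` by `Re z`; absolute integrals
thus come from the same Mellin formula. -/
theorem norm_cpow_mul_laplaceKernel {a β u : ℝ} (ha : 0 ≤ a) (hβ : 0 < β) (hu : 0 < u) (z : ℂ) :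
    ((‖(u : ℂ) ^ (-(β * z)) * (laplaceKernel β a u : ℂ)‖ : ℝ) : ℂ) =
      (u : ℂ) ^ (-(β * (z.re : ℂ))) * (laplaceKernel β a u : ℂ) := by
  rw [norm_mul, Complex.norm_cpow_eq_rpow_re_of_pos hu, Complex.norm_real, Real.norm_eq_abs,
    abs_of_nonneg (laplaceKernel_nonneg hβ ha hu), Complex.ofReal_mul,
    Complex.ofReal_cpow hu.le]
  simp

theorem integral_norm_cpow_mul_laplaceKernel {a β : ℝ} (ha : 0 < a) (hβ : 0 < β) {z : ℂ}
    (hz : z.re < 1) :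
    ∫ u in Set.Ioi (0 : ℝ), ‖(u : ℂ) ^ (-(β * z)) * (laplaceKernel β a u : ℂ)‖ =
      Real.Gamma (1 - z.re) * a ^ z.re := by
  have h := (integral_cpow_mul_laplaceKernel ha hβ (z := (z.re : ℂ)) (by simpa using hz)).2
  rw [← setIntegral_congr_fun measurableSet_Ioi
    (fun u hu => norm_cpow_mul_laplaceKernel ha.le hβ hu z), integral_complex_ofReal,
    ← Complex.ofReal_cpow ha.le, ← Complex.ofReal_one, ← Complex.ofReal_sub,
    Complex.Gamma_ofReal] at h
  exact_mod_cast h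

/-- Integrability of the Mellin kernel against the law of `A` and integrability of `A ^ Re z`
are equivalent. -/
theorem integrable_prod_laplaceKernel_iff {Ω : Type*} [MeasurableSpace Ω] {P : Measure Ω}
    [IsProbabilityMeasure P] {A : Ω → ℝ} (hA : Measurable A)
    (hA' : ∀ᵐ ω ∂P, 0 < A ω) {β : ℝ} (hβ : 0 < β) {z : ℂ} (hz : z.re < 1) :
    Integrable (fun p : ℝ × Ω => (p.1 : ℂ) ^ (-(β * z)) * (laplaceKernel β (A p.2) p.1 : ℂ))
        ((volume.restrict (Set.Ioi 0)).prod P) ↔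
      Integrable (fun ω => A ω ^ z.re) P := by
  have hm : Measurable (fun p : ℝ × Ω =>
      (p.1 : ℂ) ^ (-(β * z)) * (laplaceKernel β (A p.2) p.1 : ℂ)) := by
    have : Measurable (fun p : ℝ × Ω => laplaceKernel β (A p.2) p.1) :=
      (measurable_laplaceKernel β).comp ((hA.comp measurable_snd).prodMk measurable_fst)
    fun_prop
  rw [integrable_prod_iff' hm.aestronglyMeasurable]
  have h1 : ∀ᵐ ω ∂P, Integrable (fun u : ℝ => (u : ℂ) ^ (-(β * z)) *
      (laplaceKernel β (A ω) u : ℂ)) (volume.restrict (Set.Ioi 0)) := by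
    filter_upwards [hA'] with ω hω using (integral_cpow_mul_laplaceKernel hω hβ hz).1
  have h2 : (fun ω => ∫ u in Set.Ioi (0 : ℝ), ‖(u : ℂ) ^ (-(β * z)) *
      (laplaceKernel β (A ω) u : ℂ)‖) =ᵐ[P] fun ω => Real.Gamma (1 - z.re) * A ω ^ z.re := by
    filter_upwards [hA'] with ω hω using integral_norm_cpow_mul_laplaceKernel hω hβ hz
  have hG : Real.Gamma (1 - z.re) ≠ 0 := (Real.Gamma_pos_of_pos (by linarith)).ne'
  rw [and_iff_right h1, integrable_congr h2]
  exact integrable_const_mul_iff (isUnit_iff_ne_zero.2 hG) _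

/-- Tonelli in the other order. The right-hand side sees `A` only through the derivative of its
Laplace transform, which lets integrability pass from one variable to another. -/
theorem integrable_rpow_iff_integrableOn_laplaceKernel {Ω : Type*} [MeasurableSpace Ω]
    {P : Measure Ω} [IsProbabilityMeasure P] {A : Ω → ℝ} (hA : Measurable A)
    (hA0 : ∀ ω, 0 ≤ A ω) (hA' : ∀ᵐ ω ∂P, 0 < A ω) {β : ℝ} (hβ : 0 < β) {z : ℂ} (hz : z.re < 1) :
    Integrable (fun ω => A ω ^ z.re) P ↔
      IntegrableOn (fun u : ℝ => u ^ (-(β * z.re)) * ∫ ω, laplaceKernel β (A ω) u ∂P)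
        (Set.Ioi 0) := by
  have hm : Measurable (fun p : ℝ × Ω =>
      (p.1 : ℂ) ^ (-(β * z)) * (laplaceKernel β (A p.2) p.1 : ℂ)) := by
    have : Measurable (fun p : ℝ × Ω => laplaceKernel β (A p.2) p.1) :=
      (measurable_laplaceKernel β).comp ((hA.comp measurable_snd).prodMk measurable_fst)
    fun_prop
  rw [← integrable_prod_laplaceKernel_iff hA hA' hβ hz,
    integrable_prod_iff hm.aestronglyMeasurable, and_iff_right]
  · refine integrableOn_congr_fun (fun u (hu : 0 < u) => ?_) measurableSet_Ioi
    rw [← integral_const_mul]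
    refine integral_congr_ae (Filter.Eventually.of_forall fun ω => ?_)
    simp only [norm_mul, Complex.norm_cpow_eq_rpow_re_of_pos hu, Complex.norm_real,
      Real.norm_eq_abs, abs_of_nonneg (laplaceKernel_nonneg hβ (hA0 ω) hu)]
    simp
  · filter_upwards [self_mem_ae_restrict measurableSet_Ioi] with u hu
    exact ((hasDerivAt_integral_exp_neg_mul_rpow hA hA0 hβ hu).1.ofReal).const_mul _

theorem integral_cpow_mul_integral_laplaceKernel {Ω : Type*} [MeasurableSpace Ω]
    {P : Measure Ω} [IsProbabilityMeasure P] {A : Ω → ℝ} (hA : Measurable A)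
    (hA' : ∀ᵐ ω ∂P, 0 < A ω) {β : ℝ} (hβ : 0 < β) {z : ℂ} (hz : z.re < 1)
    (hi : Integrable (fun ω => A ω ^ z.re) P) :
    ∫ u in Set.Ioi (0 : ℝ), (u : ℂ) ^ (-(β * z)) * ((∫ ω, laplaceKernel β (A ω) u ∂P : ℝ) : ℂ) =
      Complex.Gamma (1 - z) * ∫ ω, (A ω : ℂ) ^ z ∂P := by
  have h := integral_integral_swap
    (f := fun (u : ℝ) (ω : Ω) => (u : ℂ) ^ (-(β * z)) * (laplaceKernel β (A ω) u : ℂ))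
    ((integrable_prod_laplaceKernel_iff hA hA' hβ hz).2 hi)
  rw [← integral_const_mul]
  refine Eq.trans (integral_congr_ae (Filter.Eventually.of_forall fun u => ?_))
    (h.trans (integral_congr_ae ?_))
  · simp only
    rw [integral_const_mul, integral_complex_ofReal]
  · filter_upwards [hA'] with ω hω using (integral_cpow_mul_laplaceKernel hω hβ hz).2

/-- If `E e^{-A u^β} = E' e^{-B u^γ}` for all `u > 0`, then power moments of `B` determine those
of `A`. -/
theorem integral_cpow_of_laplace_eq {Ω Ω' : Type*} [MeasurableSpace Ω] [MeasurableSpace Ω']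
    {P : Measure Ω} {Q : Measure Ω'} [IsProbabilityMeasure P] [IsProbabilityMeasure Q]
    {A : Ω → ℝ} {B : Ω' → ℝ} (hA : Measurable A) (hA0 : ∀ ω, 0 ≤ A ω) (hA' : ∀ᵐ ω ∂P, 0 < A ω)
    (hB : Measurable B) (hB0 : ∀ ω, 0 ≤ B ω) (hB' : ∀ᵐ ω ∂Q, 0 < B ω) {β γ : ℝ} (hβ : 0 < β)
    (hγ : 0 < γ)
    (hL : ∀ u : ℝ, 0 < u → ∫ ω, Real.exp (-(A ω * u ^ β)) ∂P = ∫ ω, Real.exp (-(B ω * u ^ γ)) ∂Q)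
    {z w : ℂ} (hz : z.re < 1) (hw : w.re < 1) (hzw : β * z = γ * w)
    (hi : Integrable (fun ω => B ω ^ w.re) Q) :
    Integrable (fun ω => A ω ^ z.re) P ∧
      Complex.Gamma (1 - z) * ∫ ω, (A ω : ℂ) ^ z ∂P =
        Complex.Gamma (1 - w) * ∫ ω, (B ω : ℂ) ^ w ∂Q := by
  have hK : ∀ u : ℝ, 0 < u →
      ∫ ω, laplaceKernel β (A ω) u ∂P = ∫ ω, laplaceKernel γ (B ω) u ∂Q := by
    intro u hu
    -- Laplace transforms that agree near `u` have the same derivative at `u`.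
    refine neg_injective (HasDerivAt.unique
      (hasDerivAt_integral_exp_neg_mul_rpow hA hA0 hβ hu).2 ?_)
    refine (hasDerivAt_integral_exp_neg_mul_rpow hB hB0 hγ hu).2.congr_of_eventuallyEq ?_
    filter_upwards [Ioi_mem_nhds hu] with v hv using hL v hv
  have hre : β * z.re = γ * w.re := by simpa using congrArg Complex.re hzw
  have hi' : Integrable (fun ω => A ω ^ z.re) P := by
    rw [integrable_rpow_iff_integrableOn_laplaceKernel hA hA0 hA' hβ hz]
    rw [integrable_rpow_iff_integrableOn_laplaceKernel hB hB0 hB' hγ hw] at hi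
    refine hi.congr_fun (fun u hu => ?_) measurableSet_Ioi
    simp only
    rw [hK u hu, hre]
  refine ⟨hi', ?_⟩
  rw [← integral_cpow_mul_integral_laplaceKernel hA hA' hβ hz hi',
    ← integral_cpow_mul_integral_laplaceKernel hB hB' hγ hw hi]
  refine setIntegral_congr_fun measurableSet_Ioi fun u hu => ?_
  rw [hK u hu, hzw]

/-! ### The characteristic function of the Cauchy law -/

open scoped FourierTransform

theorem fourier_exp_neg_two_pi_abs :
    𝓕 (fun x : ℝ => (Real.exp (-(2 * Real.pi * |x|)) : ℂ)) =
      fun ξ : ℝ => (cauchyPDFReal 0 1 ξ : ℂ) := by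
  ext ξ
  have hpi := Real.pi_pos
  set a : ℂ := 2 * Real.pi * (1 - ξ * Complex.I) with ha
  set b : ℂ := -(2 * Real.pi * (1 + ξ * Complex.I)) with hb
  have har : 0 < a.re := by simp [ha]; positivity
  have hbr : b.re < 0 := by simp [hb]; positivity
  rw [Real.fourier_real_eq_integral_exp_smul]
  have h1 : Set.EqOn (fun x : ℝ => Complex.exp (a * x)) (fun x : ℝ =>
      Complex.exp (↑(-2 * Real.pi * x * ξ) * Complex.I) • (Real.exp (-(2 * Real.pi * |x|)) : ℂ))
      (Set.Iic 0) := by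
    intro x hx
    simp only [smul_eq_mul]
    rw [abs_of_nonpos hx, Complex.ofReal_exp, ← Complex.exp_add, ha]
    congr 1; push_cast; ring
  have h2 : Set.EqOn (fun x : ℝ => Complex.exp (b * x)) (fun x : ℝ =>
      Complex.exp (↑(-2 * Real.pi * x * ξ) * Complex.I) • (Real.exp (-(2 * Real.pi * |x|)) : ℂ))
      (Set.Ioi 0) := by
    intro x hx
    simp only [smul_eq_mul]
    rw [abs_of_pos hx, Complex.ofReal_exp, ← Complex.exp_add, hb]
    congr 1; push_cast; ring
  rw [← intervalIntegral.integral_Iic_add_Ioi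
    ((integrableOn_exp_mul_complex_Iic har 0).congr_fun h1 measurableSet_Iic)
    ((integrableOn_exp_mul_complex_Ioi hbr 0).congr_fun h2 measurableSet_Ioi),
    ← setIntegral_congr_fun measurableSet_Iic h1, ← setIntegral_congr_fun measurableSet_Ioi h2,
    integral_exp_mul_complex_Iic har, integral_exp_mul_complex_Ioi hbr, cauchyPDFReal_def]
  have hp : (Real.pi : ℂ) ≠ 0 := by exact_mod_cast hpi.ne'
  have e1 : (1 - ξ * Complex.I : ℂ) ≠ 0 := fun h => by simpa using congrArg Complex.re h
  have e2 : (1 + ξ * Complex.I : ℂ) ≠ 0 := fun h => by simpa using congrArg Complex.re h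
  have e3 : (ξ ^ 2 + 1 : ℂ) = (1 - ξ * Complex.I) * (1 + ξ * Complex.I) := by
    ring_nf; rw [Complex.I_sq]; ring
  push_cast
  simp only [one_pow, mul_one, sub_zero, mul_zero,
    Complex.exp_zero]
  rw [e3, ha, hb]
  field_simp
  ring

theorem charFun_cauchyMeasure (t : ℝ) :
    charFun (cauchyMeasure 0 1) t = (Real.exp (-|t|) : ℂ) := by
  have hpi := Real.pi_pos
  set f : ℝ → ℂ := fun x : ℝ => (Real.exp (-(2 * Real.pi * |x|)) : ℂ) with hf
  have hc : Continuous f := by fun_prop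
  have hF : 𝓕 f = fun ξ : ℝ => (cauchyPDFReal 0 1 ξ : ℂ) := fourier_exp_neg_two_pi_abs
  have hfi : Integrable f := by
    have h : Integrable (fun x : ℝ => Real.exp (-(2 * Real.pi * |x|))) := by
      rw [← integrableOn_univ, ← Set.Iic_union_Ioi (a := (0 : ℝ)), integrableOn_union]
      constructor
      · refine (integrableOn_exp_mul_Iic (a := 2 * Real.pi) (by positivity) 0).congr_fun
          (fun x hx => ?_) measurableSet_Iic
        simp only
        rw [abs_of_nonpos hx]; ring_nf
      · refine (integrableOn_exp_mul_Ioi (a := -(2 * Real.pi)) (by linarith) 0).congr_fun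
          (fun x hx => ?_) measurableSet_Ioi
        simp only
        rw [abs_of_pos hx]; ring_nf
    exact h.ofReal
  have hFi : Integrable (𝓕 f) := by
    rw [hF]; exact (integrable_cauchyPDFReal 0).ofReal
  -- The point `t / (2π)` converts the `e^{2πixξ}` convention to that of `charFun`.
  have h := congrFun (hc.fourierInv_fourier_eq hfi hFi) (t / (2 * Real.pi))
  rw [hF, Real.fourierInv_eq'] at h
  rw [charFun_apply_real, cauchyMeasure_of_scale_ne_zero 0 one_ne_zero,
    integral_withDensity_eq_integral_toReal_smul (measurable_cauchyPDF _ _)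
      (Filter.Eventually.of_forall fun _ => ENNReal.ofReal_lt_top)]
  have e : f (t / (2 * Real.pi)) = (Real.exp (-|t|) : ℂ) := by
    simp only [hf]
    rw [abs_div, abs_of_pos (by positivity : 0 < 2 * Real.pi), mul_div_cancel₀ _ (by positivity)]
  rw [← e, ← h]
  refine integral_congr_ae (Filter.Eventually.of_forall fun x => ?_)
  simp only [cauchyPDF_def, ENNReal.toReal_ofReal (cauchyPDF_pos 0 one_ne_zero x).le]
  rw [Complex.real_smul, smul_eq_mul, mul_comm]
  congr 2
  simp only [RCLike.inner_apply, conj_trivial]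
  push_cast
  have hp : (Real.pi : ℂ) ≠ 0 := by exact_mod_cast hpi.ne'
  field_simp

/-! ### Gaussian absolute moments -/

theorem ae_ne_zero_gaussianReal : ∀ᵐ g ∂(gaussianReal 0 2), g ≠ 0 := by
  have : NullSingletonClass (gaussianReal 0 2) := nullSingletonClass_gaussianReal two_ne_zero
  rw [ae_iff]
  simp

theorem gaussianPDFReal_zero_two (x : ℝ) :
    gaussianPDFReal 0 2 x = (2 * √Real.pi)⁻¹ * Real.exp (-(4⁻¹ * |x| ^ (2 : ℝ))) := by
  have h : √(2 * Real.pi * 2) = 2 * √Real.pi := by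
    rw [show 2 * Real.pi * 2 = 2 ^ 2 * Real.pi by ring, Real.sqrt_mul (by positivity),
      Real.sqrt_sq (by norm_num)]
  rw [gaussianPDFReal_def]
  simp only [NNReal.coe_ofNat, sub_zero, h]
  congr 2
  rw [Real.rpow_two, sq_abs]; ring

theorem integral_comp_abs_of_integrableOn {f : ℝ → ℂ} (hf : IntegrableOn f (Set.Ioi 0)) :
    Integrable (fun x : ℝ => f |x|) ∧
      ∫ x : ℝ, f |x| = 2 * ∫ x in Set.Ioi (0 : ℝ), f x := by
  have h1 : Set.EqOn f (fun x => f |x|) (Set.Ioi 0) := fun x hx => by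
    simp only [abs_of_pos (show (0 : ℝ) < x from hx)]
  have h2 : Set.EqOn (fun x => f (-x)) (fun x => f |x|) (Set.Iic 0) := fun x hx => by
    simp only [abs_of_nonpos (show x ≤ (0 : ℝ) from hx)]
  have hi1 := hf.congr_fun h1 measurableSet_Ioi
  have hi2 : IntegrableOn (fun x => f |x|) (Set.Iic 0) := by
    have : IntegrableOn (fun x => f (-x)) (Set.Iio 0) :=
      IntegrableOn.comp_neg_Iio (by simpa using hf)
    exact ((integrableOn_Iic_iff_integrableOn_Iio).2 this).congr_fun h2 measurableSet_Iic
  constructor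
  · rw [← integrableOn_univ, ← Set.Iic_union_Ioi (a := (0 : ℝ))]
    exact hi2.union hi1
  · rw [← intervalIntegral.integral_Iic_add_Ioi hi2 hi1,
      ← setIntegral_congr_fun measurableSet_Ioi h1, ← setIntegral_congr_fun measurableSet_Iic h2,
      integral_comp_neg_Iic 0 f, neg_zero, two_mul]

/-- Absolute moments of the centred Gaussian law of variance `2`. -/
theorem integral_abs_cpow_gaussianReal {s : ℂ} (hs : -1 < s.re) :
    Integrable (fun g : ℝ => ((|g| : ℝ) : ℂ) ^ s) (gaussianReal 0 2) ∧
      ∫ g, ((|g| : ℝ) : ℂ) ^ s ∂(gaussianReal 0 2) =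
        2 ^ s * Complex.Gamma ((1 + s) / 2) / (√Real.pi : ℂ) := by
  have h1s : 0 < (1 + s).re := by simp; linarith
  obtain ⟨h1, h2⟩ := mellin_exp_neg_mul_rpow (a := 4⁻¹) (by norm_num) two_pos h1s
  set F : ℝ → ℂ := fun x => (2 * √Real.pi : ℂ)⁻¹ *
    ((x : ℂ) ^ s * (Real.exp (-(4⁻¹ * x ^ (2 : ℝ))) : ℂ)) with hF
  have hFi : IntegrableOn F (Set.Ioi 0) := by
    refine (Integrable.const_mul (MeasureTheory.IntegrableOn.congr_fun h1 (fun x _ => ?_)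
      measurableSet_Ioi) _)
    simp
  have hFint : ∫ x in Set.Ioi (0 : ℝ), F x =
      2⁻¹ * (2 ^ s * Complex.Gamma ((1 + s) / 2) / (√Real.pi : ℂ)) := by
    have e : ∫ x in Set.Ioi (0 : ℝ), ((x : ℂ) ^ s * (Real.exp (-(4⁻¹ * x ^ (2 : ℝ))) : ℂ)) =
        mellin (fun t : ℝ => (Real.exp (-(4⁻¹ * t ^ (2 : ℝ))) : ℂ)) (1 + s) := by
      rw [mellin]; simp
    have h4 : (((4⁻¹ : ℝ) : ℂ)) ^ (-((1 + s) / ((2 : ℝ) : ℂ))) = 2 * 2 ^ s := by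
      have : (((4⁻¹ : ℝ) : ℂ)) = ((2 : ℝ) : ℂ) ^ (-2 : ℂ) := by
        rw [Complex.cpow_neg, Complex.cpow_ofNat]; push_cast; norm_num
      have h22 : ((2 : ℝ) : ℂ) ^ (-2 : ℂ) = (((2 : ℝ) ^ (-2 : ℝ) : ℝ) : ℂ) := by
        rw [Complex.ofReal_cpow (by norm_num)]; norm_num
      have hexp : (2 : ℂ) * 2 ^ s = (2 : ℂ) ^ (1 + s) := by
        rw [Complex.cpow_add _ _ two_ne_zero, Complex.cpow_one]
      rw [hexp, this, h22, Complex.cpow_def_of_ne_zero (by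
          rw [← h22, ← this]; norm_num), ← Complex.ofReal_log (by positivity),
        Real.log_rpow two_pos, Complex.cpow_def_of_ne_zero two_ne_zero]
      congr 1
      rw [show (2 : ℂ) = ((2 : ℝ) : ℂ) by norm_num, ← Complex.ofReal_log (by positivity)]
      push_cast; ring
    rw [hF, integral_const_mul, e, h2, h4, mul_inv]
    push_cast; ring
  have hFabs : (fun x : ℝ => F |x|) =
      fun x : ℝ => gaussianPDFReal 0 2 x • ((|x| : ℝ) : ℂ) ^ s := by
    ext x
    rw [gaussianPDFReal_zero_two, hF, Complex.real_smul]; push_cast; ring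
  constructor
  · rw [gaussianReal_of_var_ne_zero 0 two_ne_zero,
      integrable_withDensity_iff_integrable_smul' (measurable_gaussianPDF 0 2)
        (Filter.Eventually.of_forall fun _ => ENNReal.ofReal_lt_top)]
    simp only [toReal_gaussianPDF]
    rw [← hFabs]
    exact (integral_comp_abs_of_integrableOn hFi).1
  · rw [integral_gaussianReal_eq_integral_smul two_ne_zero, ← hFabs]
    rw [(integral_comp_abs_of_integrableOn hFi).2, hFint]; ring

theorem integrable_abs_rpow_gaussianReal {r : ℝ} (hr : -1 < r) :
    Integrable (fun g : ℝ => |g| ^ r) (gaussianReal 0 2) := by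
  have h := (integral_abs_cpow_gaussianReal (s := (r : ℂ)) (by simpa using hr)).1.re
  refine h.congr (Filter.Eventually.of_forall fun g => ?_)
  simp only
  rw [← Complex.ofReal_cpow (abs_nonneg g)]; simp

/-! ### Stable laws: Gaussian mixing, no atom at 0, moments -/

/-- The Laplace transform of the square of a symmetric stable law. -/
theorem integral_exp_neg_sq_of_charFun {ν : Measure ℝ} [IsProbabilityMeasure ν] {α : ℝ}
    (hν : ∀ t : ℝ, charFun ν t = (Real.exp (-(|t| ^ α)) : ℂ)) {u : ℝ} (hu : 0 < u) :
    ∫ x, Real.exp (-(x ^ 2 * u ^ (1 : ℝ))) ∂ν =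
      ∫ g, Real.exp (-(|g| ^ α * u ^ (α / 2))) ∂(gaussianReal 0 2) := by
  have hi : Integrable (Function.uncurry fun x g : ℝ =>
      Complex.exp (((√u * x * g : ℝ) : ℂ) * Complex.I)) (ν.prod (gaussianReal 0 2)) := by
    refine Integrable.of_bound (C := 1) (by
      have : Continuous (Function.uncurry fun x g : ℝ =>
        Complex.exp (((√u * x * g : ℝ) : ℂ) * Complex.I)) := by
          unfold Function.uncurry; fun_prop
      exact this.aestronglyMeasurable) (Filter.Eventually.of_forall fun p => ?_)
    simp only [Function.uncurry, Complex.norm_exp_ofReal_mul_I, le_refl]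
  have h := integral_integral_swap hi
  have hl : ∀ x : ℝ, ∫ g, Complex.exp (((√u * x * g : ℝ) : ℂ) * Complex.I) ∂(gaussianReal 0 2) =
      ((Real.exp (-(x ^ 2 * u ^ (1 : ℝ))) : ℝ) : ℂ) := by
    intro x
    have := charFun_gaussianReal (μ := 0) (v := 2) (√u * x)
    rw [charFun_apply_real] at this
    push_cast at this ⊢
    rw [this]
    congr 1
    have hs : ((√u : ℝ) : ℂ) ^ 2 = (u : ℂ) := by
      exact_mod_cast Real.sq_sqrt hu.le
    rw [Real.rpow_one, mul_pow, hs]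
    simp; ring
  have hr : ∀ g : ℝ, ∫ x, Complex.exp (((√u * x * g : ℝ) : ℂ) * Complex.I) ∂ν =
      ((Real.exp (-(|g| ^ α * u ^ (α / 2))) : ℝ) : ℂ) := by
    intro g
    have := hν (√u * g)
    rw [charFun_apply_real, abs_mul, abs_of_nonneg (Real.sqrt_nonneg u),
      Real.mul_rpow (Real.sqrt_nonneg u) (abs_nonneg g), Real.sqrt_eq_rpow,
      ← Real.rpow_mul hu.le, ← Real.sqrt_eq_rpow] at this
    rw [show |g| ^ α * u ^ (α / 2) = u ^ (1 / 2 * α) * |g| ^ α by rw [mul_comm]; ring_nf, ← this]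
    refine integral_congr_ae (Filter.Eventually.of_forall fun x => ?_)
    simp only
    push_cast; ring_nf
  simp only [hl, hr, integral_complex_ofReal] at h
  exact_mod_cast h

theorem tendsto_integral_exp_neg_mul_rpow {Ω : Type*} [MeasurableSpace Ω] {P : Measure Ω}
    [IsProbabilityMeasure P] {A : Ω → ℝ} (hA : Measurable A) (hA0 : ∀ ω, 0 ≤ A ω)
    (hA' : ∀ᵐ ω ∂P, 0 < A ω) {β : ℝ} (hβ : 0 < β) :
    Filter.Tendsto (fun u : ℝ => ∫ ω, Real.exp (-(A ω * u ^ β)) ∂P) Filter.atTop (nhds 0) := by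
  rw [← integral_zero Ω ℝ (μ := P)]
  refine tendsto_integral_filter_of_dominated_convergence (fun _ => 1)
    (Filter.Eventually.of_forall fun u => ?_) ?_ (integrable_const _) ?_
  · have : Measurable fun ω => Real.exp (-(A ω * u ^ β)) := by fun_prop
    exact this.aestronglyMeasurable
  · filter_upwards [Filter.eventually_ge_atTop 0] with u hu
    refine Filter.Eventually.of_forall fun ω => ?_
    rw [Real.norm_eq_abs, Real.abs_exp, Real.exp_le_one_iff, neg_nonpos]
    exact mul_nonneg (hA0 ω) (Real.rpow_nonneg hu _)
  · filter_upwards [hA'] with ω hω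
    exact Real.tendsto_exp_neg_atTop_nhds_zero.comp
      ((tendsto_rpow_atTop hβ).const_mul_atTop hω)

theorem ae_abs_rpow_pos_gaussianReal (α : ℝ) : ∀ᵐ g ∂(gaussianReal 0 2), 0 < |g| ^ α := by
  filter_upwards [ae_ne_zero_gaussianReal] with g hg
  exact Real.rpow_pos_of_pos (abs_pos.2 hg) _

/-- For every `u > 0`, the mass at 0 is at most `E e^{-u S²} = E e^{-u^{α/2}|G|^α}`, which tends to
0 because `G ≠ 0` almost surely. -/
theorem ae_ne_zero_of_charFun {ν : Measure ℝ} [IsProbabilityMeasure ν] {α : ℝ} (hα : 0 < α)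
    (hν : ∀ t : ℝ, charFun ν t = (Real.exp (-(|t| ^ α)) : ℂ)) : ∀ᵐ x ∂ν, x ≠ 0 := by
  have hlim := tendsto_integral_exp_neg_mul_rpow (P := gaussianReal 0 2)
    (A := fun g : ℝ => |g| ^ α) (by fun_prop) (fun g => by positivity)
    (ae_abs_rpow_pos_gaussianReal α) (half_pos hα)
  have hle : ν.real {0} ≤ 0 := by
    refine ge_of_tendsto hlim ?_
    filter_upwards [Filter.eventually_gt_atTop 0] with u hu
    rw [← integral_exp_neg_sq_of_charFun hν hu, ← integral_indicator_one
      (measurableSet_singleton (0 : ℝ))]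
    refine integral_mono ((integrable_const (1 : ℝ)).indicator (measurableSet_singleton _))
      (Integrable.of_bound (C := 1) (by
        have : Measurable fun x : ℝ => Real.exp (-(x ^ 2 * u ^ (1 : ℝ))) := by fun_prop
        exact this.aestronglyMeasurable) (Filter.Eventually.of_forall fun x => ?_)) fun x => ?_
    · rw [Real.norm_eq_abs, Real.abs_exp, Real.exp_le_one_iff, neg_nonpos]
      positivity
    · by_cases hx : x = 0
      · simp [hx]
      · simp only [Set.indicator, Set.mem_singleton_iff, hx, if_false]
        positivity
  have h0 : ν {0} = 0 := by
    rw [← measureReal_eq_zero_iff]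
    exact le_antisymm hle measureReal_nonneg
  rw [ae_iff]
  simpa using h0

/-- Absolute moments of a symmetric stable law. -/
theorem integral_abs_cpow_of_charFun {ν : Measure ℝ} [IsProbabilityMeasure ν] {α : ℝ}
    (hα0 : 0 < α) (hα2 : α ≤ 2) (hν : ∀ t : ℝ, charFun ν t = (Real.exp (-(|t| ^ α)) : ℂ))
    {s : ℂ} (hs : -1 < s.re) (hsα : s.re < α) :
    Integrable (fun x : ℝ => ((|x| : ℝ) : ℂ) ^ s) ν ∧
      ∫ x, ((|x| : ℝ) : ℂ) ^ s ∂ν =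
        2 ^ s * (Complex.Gamma ((1 + s) / 2) * Complex.Gamma (1 - s / (α : ℂ))) /
          ((Real.sqrt Real.pi : ℂ) * Complex.Gamma (1 - s / 2)) := by
  have hne := ae_ne_zero_of_charFun hα0 hν
  have hα' : (α : ℂ) ≠ 0 := by exact_mod_cast hα0.ne'
  -- The conventions for powers of 0 make this hold at `x = 0` too, so it rewrites integrands
  -- pointwise.
  have hpow : ∀ (x r : ℝ) (hr : r ≠ 0), ((|x| ^ r : ℝ) : ℂ) ^ (s / r) = ((|x| : ℝ) : ℂ) ^ s := by
    intro x r hr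
    rcases eq_or_ne x 0 with rfl | hx
    · rw [abs_zero, Real.zero_rpow hr, Complex.ofReal_zero]
      rcases eq_or_ne s 0 with rfl | hs0
      · simp
      · rw [Complex.zero_cpow hs0, Complex.zero_cpow
          (div_ne_zero hs0 (by exact_mod_cast hr))]
    · have hx' := abs_pos.2 hx
      rw [Complex.cpow_def_of_ne_zero (by
          exact_mod_cast (Real.rpow_pos_of_pos hx' r).ne'), ← Complex.ofReal_log (by positivity),
        Real.log_rpow hx', Complex.cpow_def_of_ne_zero (by exact_mod_cast hx'.ne'),
        ← Complex.ofReal_log hx'.le]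
      have : (r : ℂ) ≠ 0 := by exact_mod_cast hr
      congr 1; push_cast; field_simp
  have hsq : ∀ x : ℝ, ((x ^ 2 : ℝ) : ℂ) ^ (s / 2) = ((|x| : ℝ) : ℂ) ^ s := by
    intro x
    have := hpow x 2 two_ne_zero
    rwa [Real.rpow_two, sq_abs, Complex.ofReal_ofNat] at this
  have hre2 : (s / 2).re = s.re / 2 := by simp
  -- With `β = 1` and `γ = α/2`, the exponents `s/2` and `s/α` satisfy `βz = γw`. The condition `Re
  -- (s/2) < 1` is where `α ≤ 2` enters.
  obtain ⟨h1, h2⟩ := integral_cpow_of_laplace_eq (P := ν) (Q := gaussianReal 0 2)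
    (A := fun x : ℝ => x ^ 2) (B := fun g : ℝ => |g| ^ α) (by fun_prop) (fun x => sq_nonneg x)
    (by filter_upwards [hne] with x hx; positivity) (by fun_prop) (fun g => by positivity)
    (ae_abs_rpow_pos_gaussianReal α) one_pos (half_pos hα0)
    (fun u hu => integral_exp_neg_sq_of_charFun hν hu) (z := s / 2) (w := s / α)
    (by rw [hre2]; linarith) (by rw [Complex.div_ofReal_re, div_lt_one hα0]; exact hsα)
    (by push_cast; field_simp)
    (by
      refine (integrable_abs_rpow_gaussianReal hs).congr (Filter.Eventually.of_forall fun g => ?_)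
      simp only
      rw [← Real.rpow_mul (abs_nonneg g), Complex.div_ofReal_re, mul_div_cancel₀ _ hα0.ne'])
  simp only [hsq, hpow _ _ hα0.ne'] at h2
  constructor
  · refine h1.mono' (by
      have : Measurable fun x : ℝ => ((|x| : ℝ) : ℂ) ^ s := by fun_prop
      exact this.aestronglyMeasurable) ?_
    filter_upwards [hne] with x hx
    rw [Complex.norm_cpow_eq_rpow_re_of_pos (abs_pos.2 hx), hre2, ← sq_abs, ← Real.rpow_two,
      ← Real.rpow_mul (abs_nonneg x), mul_div_cancel₀ _ two_ne_zero]
  · have hG : Complex.Gamma (1 - s / 2) ≠ 0 :=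
      Complex.Gamma_ne_zero_of_re_pos (by rw [Complex.sub_re, hre2]; simp; linarith)
    rw [(integral_abs_cpow_gaussianReal hs).2] at h2
    have hp : ((√Real.pi : ℝ) : ℂ) ≠ 0 := by
      exact_mod_cast (Real.sqrt_pos.2 Real.pi_pos).ne'
    rw [eq_div_iff (mul_ne_zero hp hG)]
    calc _ = (√Real.pi : ℂ) * (Complex.Gamma (1 - s / 2) * ∫ x, ((|x| : ℝ) : ℂ) ^ s ∂ν) := by ring
      _ = _ := by rw [h2]; field_simp

/-! ### The case `α = 1` and the main theorem -/

/-- Legendre duplication at `(1 - s)/2`. -/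
theorem stable_moment_one_eq_gamma {s : ℂ} (hs : s.re < 1) :
    2 ^ s * (Complex.Gamma ((1 + s) / 2) * Complex.Gamma (1 - s)) /
      ((Real.sqrt Real.pi : ℂ) * Complex.Gamma (1 - s / 2)) =
        Complex.Gamma ((1 + s) / 2) * Complex.Gamma ((1 - s) / 2) / (Real.pi : ℂ) := by
  have h := Complex.Gamma_mul_Gamma_add_half ((1 - s) / 2)
  rw [show (1 - s) / 2 + 1 / 2 = 1 - s / 2 by ring, show 2 * ((1 - s) / 2) = 1 - s by ring,
    show 1 - (1 - s) = s by ring] at h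
  have hp : ((√Real.pi : ℝ) : ℂ) ≠ 0 := by exact_mod_cast (Real.sqrt_pos.2 Real.pi_pos).ne'
  have hpp : (Real.pi : ℂ) = (√Real.pi : ℂ) * (√Real.pi : ℂ) := by
    exact_mod_cast (Real.mul_self_sqrt Real.pi_pos.le).symm
  have hG : Complex.Gamma (1 - s / 2) ≠ 0 :=
    Complex.Gamma_ne_zero_of_re_pos (by simp; linarith)
  rw [hpp, div_eq_div_iff (mul_ne_zero hp hG) (mul_ne_zero hp hp)]
  linear_combination (-(√Real.pi : ℂ) * Complex.Gamma ((1 + s) / 2)) * h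

/-- Euler reflection at `(1 + s)/2`. At odd integers `s` both sides are 0 by convention, so `s` is
unrestricted. -/
theorem Gamma_mul_Gamma_half_sub_div_pi (s : ℂ) :
    Complex.Gamma ((1 + s) / 2) * Complex.Gamma ((1 - s) / 2) / (Real.pi : ℂ) =
      1 / Complex.cos ((Real.pi : ℂ) * s / 2) := by
  have h := Complex.Gamma_mul_Gamma_one_sub ((1 + s) / 2)
  have hp : (Real.pi : ℂ) ≠ 0 := by exact_mod_cast Real.pi_ne_zero
  rw [show 1 - (1 + s) / 2 = (1 - s) / 2 by ring,
    show (Real.pi : ℂ) * ((1 + s) / 2) = Real.pi * s / 2 + Real.pi / 2 by ring,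
    Complex.sin_add_pi_div_two] at h
  rw [h]
  field_simp

theorem mainTheorem2 {Ω : Type*} [MeasurableSpace Ω] (μ : Measure Ω) [IsProbabilityMeasure μ]
    (α : ℝ) (hα0 : 0 < α) (hα2 : α ≤ 2) (S : Ω → ℝ) (hS : IsSymmetricStable S α μ) :
    (∀ᵐ ω ∂μ, S ω ≠ 0) ∧
    (∀ s : ℂ, -1 < s.re → s.re < α →
      Integrable (fun ω => ((|S ω| : ℝ) : ℂ) ^ s) μ ∧
      ∫ ω, ((|S ω| : ℝ) : ℂ) ^ s ∂μ =
        2 ^ s * (Complex.Gamma ((1 + s) / 2) * Complex.Gamma (1 - s / (α : ℂ))) /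
          ((Real.sqrt Real.pi : ℂ) * Complex.Gamma (1 - s / 2))) ∧
    (α = 1 →
      μ.map S = cauchyMeasure 0 1 ∧
      ∀ s : ℂ, -1 < s.re → s.re < 1 →
        ∫ ω, ((|S ω| : ℝ) : ℂ) ^ s ∂μ =
          Complex.Gamma ((1 + s) / 2) * Complex.Gamma ((1 - s) / 2) / (Real.pi : ℂ) ∧
        ∫ ω, ((|S ω| : ℝ) : ℂ) ^ s ∂μ = 1 / Complex.cos ((Real.pi : ℂ) * s / 2)) := by
  obtain ⟨hSm, hchar⟩ := hS
  have hprob : IsProbabilityMeasure (μ.map S) := Measure.isProbabilityMeasure_map hSm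
  have hmain : ∀ s : ℂ, -1 < s.re → s.re < α →
      Integrable (fun ω => ((|S ω| : ℝ) : ℂ) ^ s) μ ∧
      ∫ ω, ((|S ω| : ℝ) : ℂ) ^ s ∂μ =
        2 ^ s * (Complex.Gamma ((1 + s) / 2) * Complex.Gamma (1 - s / (α : ℂ))) /
          ((Real.sqrt Real.pi : ℂ) * Complex.Gamma (1 - s / 2)) := by
    intro s hs hsα
    have h := integral_abs_cpow_of_charFun hα0 hα2 hchar hs hsα
    have hm : Measurable fun x : ℝ => ((|x| : ℝ) : ℂ) ^ s := by fun_prop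
    rwa [integrable_map_measure hm.aestronglyMeasurable hSm,
      integral_map hSm hm.aestronglyMeasurable] at h
  refine ⟨ae_of_ae_map hSm (ae_ne_zero_of_charFun hα0 hchar), hmain, ?_⟩
  rintro rfl
  refine ⟨Measure.ext_of_charFun ?_, fun s hs hs1 => ?_⟩
  · ext t
    rw [hchar, charFun_cauchyMeasure, Real.rpow_one]
  · have h := (hmain s hs hs1).2
    rw [Complex.ofReal_one, div_one, stable_moment_one_eq_gamma hs1] at h
    exact ⟨h, h.trans (Gamma_mul_Gamma_half_sub_div_pi s)⟩
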